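/- Let $\operatorname{Log}$ be the principal logarithm on $\mathcal A=\mathbb C\setminus(-\infty,0]$ and put $$G(z)=\Bigl(1-\frac{\operatorname{Log} z}{\operatorname{Log}(1+z)}\Bigr)\,z\operatorname{Log} z,\qquad z\in\mathcal A.$$ Let $$\rho(t)=\begin{cases}-\dfrac{t\ln((1-t)/t^2)}{\ln(1-t)}, & 0<t<1,\\[2mm] -\dfrac{t\,(\ln((t-1)/t))^2}{(\ln(t-1))^2+\pi^2}, & t>1,\end{cases}\qquad \rho(1)=-1,$$ and $$\varphi(s)=\int_0^\infty e^{-st}\rho(t)\,dt,\qquad s\ge 0.$$ **Proposition.** The function $\varphi$ is square integrable on $[0,\infty)$. The function $t\mapsto 1-G(a+it)$ is square integrable on $\mathbb R$ for every $a\ge 0$ (for $a=0$ it is defined for $t\neq0$), and $$\lim_{a\to0^+}\int_{-\infty}^\infty|1-G(a+it)|^2\,\frac{dt}{2\pi}=\int_{-\infty}^\infty|1-G(it)|^2\,\frac{dt}{2\pi}=\int_0^\infty\varphi(s)^2\,ds.$$ Moreover, $t\mapsto 1-G(it)$ is the $L^2$-Fourier transform of $\varphi\cdot 1_{[0,\infty)}$.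 Here the $L^2$-Fourier transform is the continuous extension to $L^2(\mathbb R)$ of $f\mapsto\hat f$, $\hat f(t)=\int_{-\infty}^\infty e^{-its}f(s)\,ds$. -/

import Mathlib

open MeasureTheory Filter Topology Set
open scoped FourierTransform

noncomputable section

namespace CutPlane

/-- `G(z) = (1 - Log z / Log (1 + z)) z Log z`, with `Log` the principal logarithm. -/
def G (z : ℂ) : ℂ :=
  (1 - Complex.log z / Complex.log (1 + z)) * z * Complex.log z

/-- The density `ρ` on `(0, ∞)`; at `t = 1` it takes the common one-sided limit `-1`. -/
def rho (t : ℝ) : ℝ :=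
  if t < 1 then -(t * Real.log ((1 - t) / t ^ 2) / Real.log (1 - t))
  else if 1 < t then
    -(t * Real.log ((t - 1) / t) ^ 2 / (Real.log (t - 1) ^ 2 + Real.pi ^ 2))
  else -1

/-- `φ(s) = ∫_0^∞ e^{-st} ρ(t) dt`, used for `s ≥ 0`. -/
def phi (s : ℝ) : ℝ :=
  ∫ t in Ioi (0 : ℝ), Real.exp (-(s * t)) * rho t

/-- The function `φ · 1_{[0,∞)}` on the real line. -/
def phiPos : ℝ → ℂ :=
  indicator (Ici (0 : ℝ)) (fun s => (phi s : ℂ))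

/-- The `L²`-Fourier transform in the normalisation `f̂(t) = ∫ e^{-its} f(s) ds`. Mathlib's
`L²`-Fourier transform `𝓕` extends `ξ ↦ ∫ e^{-2πiξs} f(s) ds`, so that `f̂(t) = (𝓕 f)(t / 2π)`.
The value is an element of `L²`, so this representative is determined up to null sets. -/
def fourierL2 (f : Lp ℂ 2 (volume : Measure ℝ)) (t : ℝ) : ℂ :=
  (𝓕 f : Lp ℂ 2 (volume : Measure ℝ)) (t / (2 * Real.pi))

end CutPlane

end

namespace CutPlane

open ComplexConjugate

/-! The function `1 - G` is holomorphic on the cut plane and is bounded by a multiple of `min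
(|z|^(-1/4)) (|z|^(-3/4))` (`exists_norm_one_sub_G_le`). The imaginary part of its boundary value
from above at `-t` is `-π ρ(t)`. Cauchy's formula, with the contour collapsed onto the cut, then
gives `1 - G(z) = ∫ ρ(t)/(z+t) dt` for `Re z > 0` (`one_sub_G_eq_integral`).

Expanding `1/(z+t)` as a Laplace integral and applying Fubini turns this into `1 - G(z) = ∫ e^{-zs}
φ(s) ds` (`integral_exp_mul_phi`). So on the line `Re z = a > 0`, `1 - G` is the Fourier transform
of the integrable function `e^{-as} φ(s) 1_{[0,∞)}`.

The bound on `1 - G` gives a square integrable majorant common to all vertical lines, and also puts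
`φ` in `L²`. Letting `a → 0` in the pairing with Schwartz functions identifies the `L²`-transform of
`φ · 1_{[0,∞)}` (`fourier_phiPos`); Plancherel gives the norm identity, and dominated convergence
gives the limit of the integrals. -/

/-! ### Regularity, symmetry and boundary values of `G` -/

theorem continuousOn_log_upper : ContinuousOn Complex.log {z : ℂ | 0 ≤ z.im ∧ z ≠ 0} := by
  rintro z ⟨him, hz⟩
  by_cases h : z ∈ Complex.slitPlane
  · exact (continuousAt_clog h).continuousWithinAt
  · have h' := Complex.mem_slitPlane_iff.not.1 h
    push Not at h'
    have hre : z.re < 0 := lt_of_le_of_ne h'.1 fun h0 => hz (Complex.ext h0 h'.2)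
    exact (Complex.continuousWithinAt_log_of_re_neg_of_im_zero hre h'.2).mono fun w hw => hw.1

theorem log_ne_zero {z : ℂ} (h0 : z ≠ 0) (h1 : z ≠ 1) : Complex.log z ≠ 0 := fun h => h1 <| by
  rw [← Complex.exp_log h0, h, Complex.exp_zero]

/-- The real part `log ‖z‖` tends to `-∞`. The full neighbourhood filter is allowed because
`(Complex.log 0)⁻¹ = 0` is already the limit; this makes `G` continuous at `-1`. -/
theorem tendsto_inv_log_zero : Tendsto (fun z : ℂ => (Complex.log z)⁻¹) (𝓝 0) (𝓝 0) := by
  have key : Tendsto (fun z : ℂ => (Complex.log z)⁻¹) (𝓝[≠] 0) (𝓝 0) := by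
    refine tendsto_inv₀_cobounded.comp ?_
    rw [← tendsto_norm_atTop_iff_cobounded]
    have h1 : Tendsto (fun z : ℂ => |Real.log ‖z‖|) (𝓝[≠] 0) atTop :=
      tendsto_abs_atBot_atTop.comp (Real.tendsto_log_nhdsGT_zero.comp
        (tendsto_norm_nhdsNE_zero))
    refine tendsto_atTop_mono (fun z => ?_) h1
    rw [← Complex.log_re]
    exact Complex.abs_re_le_norm _
  rw [← nhdsNE_sup_pure (0 : ℂ), tendsto_sup]
  refine ⟨by rwa [nhdsNE_sup_pure], ?_⟩
  rw [tendsto_pure_left]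
  intro s hs
  rw [nhdsNE_sup_pure] at hs
  simpa using mem_of_mem_nhds hs

theorem continuousOn_inv_log_upper :
    ContinuousOn (fun z => (Complex.log z)⁻¹) {z : ℂ | 0 ≤ z.im ∧ z ≠ 1} := by
  rintro z ⟨him, hz⟩
  rcases eq_or_ne z 0 with rfl | h0
  · refine ContinuousAt.continuousWithinAt ?_
    simpa [ContinuousAt] using tendsto_inv_log_zero
  · have h1 : ContinuousWithinAt Complex.log {z : ℂ | 0 ≤ z.im ∧ z ≠ 1} z := by
      refine (continuousOn_log_upper z ⟨him, h0⟩).mono_of_mem_nhdsWithin ?_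
      have h2 : {w : ℂ | w ≠ 0} ∈ 𝓝[{z : ℂ | 0 ≤ z.im ∧ z ≠ 1}] z :=
        mem_nhdsWithin_of_mem_nhds (isOpen_ne.mem_nhds h0)
      filter_upwards [h2, self_mem_nhdsWithin] with w hw hw'
      exact ⟨hw'.1, hw⟩
    exact h1.inv₀ (log_ne_zero h0 hz)

theorem continuousOn_G : ContinuousOn G {z : ℂ | 0 ≤ z.im ∧ z ≠ 0} := by
  have h1 := continuousOn_log_upper
  have h2 : ContinuousOn (fun z : ℂ => (Complex.log (1 + z))⁻¹) {z : ℂ | 0 ≤ z.im ∧ z ≠ 0} :=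
    continuousOn_inv_log_upper.comp (f := fun z : ℂ => 1 + z) (by fun_prop) (by
      rintro z ⟨h, h'⟩
      simpa using ⟨h, h'⟩)
  unfold G
  simp only [div_eq_mul_inv]
  exact ((continuousOn_const.sub (h1.mul h2)).mul continuousOn_id).mul h1

theorem one_add_mem_slitPlane {z : ℂ} (hz : z ∈ Complex.slitPlane) : 1 + z ∈ Complex.slitPlane := by
  rw [Complex.mem_slitPlane_iff] at *
  rcases hz with h | h
  · left; simp; linarith
  · right; simpa using h

theorem differentiableAt_G {z : ℂ} (hz : z ∈ Complex.slitPlane) : DifferentiableAt ℂ G z := by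
  have h1 := one_add_mem_slitPlane hz
  have hl : Complex.log (1 + z) ≠ 0 :=
    log_ne_zero (Complex.slitPlane_ne_zero h1) (by simpa using Complex.slitPlane_ne_zero hz)
  have hd : DifferentiableAt ℂ (fun z : ℂ => Complex.log (1 + z)) z :=
    (by fun_prop : DifferentiableAt ℂ (fun z : ℂ => 1 + z) z).clog h1
  have hd' : DifferentiableAt ℂ Complex.log z := Complex.differentiableAt_log hz
  unfold G
  exact (((differentiableAt_const _).sub (hd'.div hd hl)).mul differentiableAt_id).mul hd'

theorem G_conj {z : ℂ} (hz : z ∈ Complex.slitPlane) : G (conj z) = conj (G z) := by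
  have h1 := one_add_mem_slitPlane hz
  have e1 : Complex.log (conj z) = conj (Complex.log z) :=
    Complex.log_conj _ (Complex.mem_slitPlane_iff_arg.1 hz).1
  have e2 : Complex.log (1 + conj z) = conj (Complex.log (1 + z)) := by
    rw [← Complex.log_conj _ (Complex.mem_slitPlane_iff_arg.1 h1).1]; simp
  simp [G, e1, e2]

/-- `Complex.log` has argument `π` on the negative axis, so `G (-t)` is the boundary value from the
upper half-plane. -/
theorem im_G_neg {t : ℝ} (ht : 0 < t) : (G (-(t : ℂ))).im = Real.pi * rho t := by
  have hlog : ∀ s : ℝ, 0 < s → Complex.log (-(s : ℂ)) = Real.log s + Real.pi * Complex.I := by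
    intro s hs
    rw [Complex.log, norm_neg, Complex.norm_real, Real.norm_of_nonneg hs.le, ← Complex.ofReal_neg,
      Complex.arg_ofReal_of_neg (by linarith)]
  have hpi := Real.pi_pos
  unfold G rho
  rw [hlog t ht]
  rcases lt_trichotomy t 1 with h | rfl | h
  · have e : Complex.log (1 + -(t : ℂ)) = ((Real.log (1 - t) : ℝ) : ℂ) := by
      rw [Complex.ofReal_log (by linarith)]; push_cast; ring_nf
    have hm : Real.log (1 - t) ≠ 0 := (Real.log_neg (by linarith) (by linarith)).ne
    rw [e, if_pos h, Real.log_div (by linarith) (by positivity), Real.log_pow]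
    simp [Complex.div_re, Complex.div_im, Complex.normSq_apply]
    field_simp
    ring
  -- At `t = 1` the conventions for `log 0` and division by zero give the quotient the value `0`,
  -- which is its limit.
  · simp [Complex.mul_im]
  · have e : Complex.log (1 + -(t : ℂ)) = Real.log (t - 1) + Real.pi * Complex.I := by
      rw [← hlog _ (by linarith)]; push_cast; ring_nf
    rw [e, if_neg (by linarith), if_pos h, Real.log_div (by linarith) (by linarith)]
    have hm : Real.log (t - 1) ^ 2 + Real.pi ^ 2 ≠ 0 := by positivity
    have hm' : Real.log (t - 1) * Real.log (t - 1) + Real.pi * Real.pi ≠ 0 := by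
      convert hm using 1; ring
    simp [Complex.div_re, Complex.div_im, Complex.normSq_apply]
    field_simp
    ring

/-! ### Size of `1 - G` and of `ρ` -/

/-- The argument of `w` lies in `[0, π]` and that of `1 + w⁻¹` in `[-π/2, 0]`, so their sum stays in
`(-π, π]`. -/
theorem log_one_add_eq {w : ℂ} (him : 0 ≤ w.im) (hw : 4 ≤ ‖w‖) :
    Complex.log (1 + w) = Complex.log w + Complex.log (1 + w⁻¹) := by
  have hw0 : w ≠ 0 := by rintro rfl; norm_num at hw
  have hinv : ‖w⁻¹‖ ≤ 1 / 4 := by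
    rw [norm_inv, one_div]; exact inv_anti₀ (by norm_num) hw
  have hne : 1 + w⁻¹ ≠ 0 := by
    intro h
    rw [eq_neg_of_add_eq_zero_right h] at hinv; norm_num at hinv
  have hre : 0 < (1 + w⁻¹).re := by
    have := (abs_le.1 ((Complex.abs_re_le_norm w⁻¹).trans hinv)).1
    simp only [Complex.add_re, Complex.one_re]; linarith
  have him' : (1 + w⁻¹).im ≤ 0 := by
    simp only [Complex.add_im, Complex.one_im, zero_add, Complex.inv_im]
    exact div_nonpos_of_nonpos_of_nonneg (by linarith) (Complex.normSq_nonneg _)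
  have e : 1 + w = w * (1 + w⁻¹) := by field_simp; ring
  rw [e, Complex.log_mul hw0 hne]
  have a1 := Complex.arg_nonneg_iff.2 him
  have a2 := Complex.arg_le_pi w
  have a3 := abs_le.1 (Complex.abs_arg_le_pi_div_two_iff.2 hre.le)
  have a4 : (1 + w⁻¹).arg ≤ 0 := by
    rcases him'.lt_or_eq with h | h
    · exact (Complex.arg_neg_iff.2 h).le
    · exact (Complex.arg_eq_zero_iff.2 ⟨hre.le, h⟩).le
  constructor <;> linarith [Real.pi_pos, a3.1]

/-- With `L = Log(1+w)` and `u = Log(1+1/w)`, one has `G = wu - wu²/L`. Since `u = 1/w + O(|w|⁻²)`,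
the leading term cancels the `1`. The radius `4` gives `|1+w| ≥ 3 > e`, hence `|L| ≥ 1`. -/
theorem norm_one_sub_G_le_of_large {w : ℂ} (him : 0 ≤ w.im) (hw : 4 ≤ ‖w‖) :
    ‖1 - G w‖ ≤ 4 * ‖w‖⁻¹ := by
  have hw0 : w ≠ 0 := by rintro rfl; norm_num at hw
  have hinv : ‖w⁻¹‖ ≤ 1 / 4 := by
    rw [norm_inv, one_div]; exact inv_anti₀ (by norm_num) hw
  set u := Complex.log (1 + w⁻¹) with hu
  set L := Complex.log (1 + w) with hL
  have e : Complex.log w = L - u := by rw [hL, log_one_add_eq him hw]; ring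
  have hwp : 0 < ‖w‖ := by linarith
  have hLn : 1 ≤ ‖L‖ := by
    have h1 : Real.log ‖1 + w‖ ≤ ‖L‖ := by
      rw [← Complex.log_re]; exact Complex.re_le_norm _
    have h2 : 3 ≤ ‖1 + w‖ := by
      have := norm_sub_norm_le w (-1 : ℂ)
      rw [sub_neg_eq_add, add_comm w, norm_neg, norm_one] at this; linarith
    refine le_trans ?_ h1
    rw [Real.le_log_iff_exp_le (by linarith)]
    linarith [Real.exp_one_lt_d9]
  have hL0 : L ≠ 0 := by rintro h; rw [h] at hLn; norm_num at hLn
  have hu1 : ‖u‖ ≤ 3 / 2 * ‖w‖⁻¹ := by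
    rw [← norm_inv]; exact Complex.norm_log_one_add_half_le_self (by linarith)
  have hu2 : ‖u - w⁻¹‖ ≤ ‖w‖⁻¹ ^ 2 := by
    refine (Complex.norm_log_one_add_sub_self_le (by linarith)).trans ?_
    rw [← norm_inv]
    have : (1 - ‖w⁻¹‖)⁻¹ ≤ 2 := by
      rw [inv_le_comm₀ (by linarith) (by norm_num)]; linarith
    nlinarith [sq_nonneg ‖w⁻¹‖]
  have key : 1 - G w = -(w * (u - w⁻¹)) + w * u * u / L := by
    unfold G
    rw [e, ← hL]
    field_simp
    ring
  have hu3 : ‖w * u * u / L‖ ≤ 9 / 4 * ‖w‖⁻¹ := by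
    rw [norm_div, norm_mul, norm_mul]
    refine (div_le_self (by positivity) hLn).trans ?_
    calc ‖w‖ * ‖u‖ * ‖u‖ ≤ ‖w‖ * (3 / 2 * ‖w‖⁻¹) * (3 / 2 * ‖w‖⁻¹) := by gcongr
      _ = 9 / 4 * ‖w‖⁻¹ := by field_simp; norm_num
  have hu4 : ‖w * (u - w⁻¹)‖ ≤ ‖w‖⁻¹ := by
    rw [norm_mul]
    calc ‖w‖ * ‖u - w⁻¹‖ ≤ ‖w‖ * ‖w‖⁻¹ ^ 2 := by gcongr
      _ = ‖w‖⁻¹ := by field_simp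
  rw [key]
  refine (norm_add_le _ _).trans ?_
  rw [norm_neg]
  have : 0 ≤ ‖w‖⁻¹ := by positivity
  linarith

/-- Since `w / Log(1+w)` is bounded near `0`, the singularity is that of `Log² w`, which a small
negative power absorbs. -/
theorem norm_one_sub_G_le_of_small {w : ℂ} (hw0 : w ≠ 0) (hw : ‖w‖ ≤ 1 / 2) :
    ‖1 - G w‖ ≤ 301 * ‖w‖ ^ (-(1 / 4) : ℝ) := by
  have hwp : 0 < ‖w‖ := norm_pos_iff.2 hw0
  set x := ‖w‖ with hx
  have hy : 1 ≤ x ^ (-(1 / 8) : ℝ) := Real.one_le_rpow_of_pos_of_le_one_of_nonpos hwp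
    (by linarith) (by norm_num)
  set y := x ^ (-(1 / 8) : ℝ) with hyd
  have hyy : x ^ (-(1 / 4) : ℝ) = y ^ 2 := by
    rw [hyd, ← Real.rpow_natCast, ← Real.rpow_mul hwp.le]; norm_num
  -- The `12` is `8` from the bound on `log` by the power `1/8`, plus `4 > π` for the argument,
  -- using `y ≥ 1`. Then `301 = 1 + 12 + 2 · 12²`.
  have hlog : ‖Complex.log w‖ ≤ 12 * y := by
    have h1 : |Real.log x| ≤ 8 * y := by
      rw [abs_of_nonpos (Real.log_nonpos hwp.le (by linarith)), ← Real.log_inv]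
      refine (Real.log_le_rpow_div (inv_nonneg.2 hwp.le) (by norm_num : (0:ℝ) < 1 / 8)).trans ?_
      rw [Real.inv_rpow hwp.le, ← Real.rpow_neg hwp.le, ← hyd]
      linarith
    have h2 := Complex.norm_le_abs_re_add_abs_im (Complex.log w)
    rw [Complex.log_re, Complex.log_im] at h2
    have h3 := Complex.abs_arg_le_pi w
    have h4 := Real.pi_lt_four
    linarith
  have hl : x / 2 ≤ ‖Complex.log (1 + w)‖ := by
    have h1 := Complex.norm_log_one_add_sub_self_le (z := w) (by linarith)
    have h2 := norm_sub_norm_le w (Complex.log (1 + w))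
    rw [norm_sub_rev] at h2
    have h3 : (1 - ‖w‖)⁻¹ ≤ 2 := by
      rw [inv_le_comm₀ (by linarith) (by norm_num)]; linarith
    rw [← hx] at h1 h2 h3
    have : x ^ 2 * (1 - x)⁻¹ / 2 ≤ x ^ 2 := by nlinarith [sq_nonneg x]
    nlinarith
  have key : 1 - G w = 1 - w * Complex.log w +
      w / Complex.log (1 + w) * (Complex.log w * Complex.log w) := by
    unfold G; ring
  have hq : ‖w / Complex.log (1 + w)‖ ≤ 2 := by
    rw [norm_div, div_le_iff₀ (by linarith)]; linarith
  rw [key, hyy]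
  calc _ ≤ ‖(1 : ℂ)‖ + ‖w * Complex.log w‖ +
        ‖w / Complex.log (1 + w) * (Complex.log w * Complex.log w)‖ :=
        (norm_add_le _ _).trans (by gcongr; exact norm_sub_le _ _)
    _ ≤ 1 + 1 * (12 * y) + 2 * ((12 * y) * (12 * y)) := by
        rw [norm_one, norm_mul, norm_mul, norm_mul, ← hx]
        gcongr
        linarith
    _ ≤ 301 * y ^ 2 := by nlinarith

/-- The weight `min (r ^ (-1/4)) (r ^ (-3/4))`, which dominates `1 - G` on the circle of radius `r`
and is square integrable on `(0, ∞)`. -/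
noncomputable def weight (r : ℝ) : ℝ := min (r ^ (-(1 / 4) : ℝ)) (r ^ (-(3 / 4) : ℝ))

theorem weight_nonneg {r : ℝ} (hr : 0 ≤ r) : 0 ≤ weight r := by unfold weight; positivity

theorem weight_anti {r s : ℝ} (hr : 0 < r) (hrs : r ≤ s) : weight s ≤ weight r :=
  min_le_min (Real.rpow_le_rpow_of_nonpos hr hrs (by norm_num))
    (Real.rpow_le_rpow_of_nonpos hr hrs (by norm_num))

theorem exists_norm_one_sub_G_le_upper : ∃ C : ℝ, 0 ≤ C ∧ ∀ w : ℂ, 0 ≤ w.im → w ≠ 0 →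
    ‖1 - G w‖ ≤ C * weight ‖w‖ := by
  have hK : IsCompact ({w : ℂ | 0 ≤ w.im ∧ 1 / 2 ≤ ‖w‖} ∩ Metric.closedBall 0 4) := by
    refine (isCompact_closedBall _ _).inter_left ?_
    exact (isClosed_le continuous_const Complex.continuous_im).inter
      (isClosed_le continuous_const continuous_norm)
  obtain ⟨M, hM⟩ := hK.exists_bound_of_continuousOn (f := fun w => 1 - G w)
    ((continuousOn_const.sub continuousOn_G).mono (by
      rintro w ⟨⟨h1, h2⟩, -⟩
      refine ⟨h1, ?_⟩
      rintro rfl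
      norm_num at h2))
  -- On the middle range `1/2 < ‖w‖ < 4` the weight is at least `1/4`, so the compactness bound `M`
  -- costs a factor `4`.
  refine ⟨301 + 4 * |M|, by positivity, fun w him hw0 => ?_⟩
  have hwp : 0 < ‖w‖ := norm_pos_iff.2 hw0
  have hwt := weight_nonneg hwp.le
  have hMp := abs_nonneg M
  rcases le_or_gt ‖w‖ (1 / 2) with h | h
  · have e : weight ‖w‖ = ‖w‖ ^ (-(1 / 4) : ℝ) := min_eq_left
      (Real.rpow_le_rpow_of_exponent_ge hwp (by linarith) (by norm_num))
    rw [e] at *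
    refine (norm_one_sub_G_le_of_small hw0 h).trans ?_
    gcongr; linarith
  rcases le_or_gt 4 ‖w‖ with h' | h'
  · refine (norm_one_sub_G_le_of_large him h').trans ?_
    have e : ‖w‖⁻¹ ≤ weight ‖w‖ := by
      rw [← Real.rpow_neg_one]
      exact le_min (Real.rpow_le_rpow_of_exponent_le (by linarith) (by norm_num))
        (Real.rpow_le_rpow_of_exponent_le (by linarith) (by norm_num))
    gcongr; linarith
  · have h1 : ‖1 - G w‖ ≤ M := hM w ⟨⟨him, h.le⟩, by simpa using h'.le⟩
    have h2 : 1 / 4 ≤ weight ‖w‖ := by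
      refine le_trans (le_of_eq_of_le (b := (4 : ℝ) ^ (-1 : ℝ)) ?_ ?_) (weight_anti hwp h'.le)
      · rw [Real.rpow_neg_one]; norm_num
      · exact le_min (Real.rpow_le_rpow_of_exponent_le (by norm_num) (by norm_num))
          (Real.rpow_le_rpow_of_exponent_le (by norm_num) (by norm_num))
    have h3 := le_abs_self M
    nlinarith

theorem exists_norm_one_sub_G_le : ∃ C : ℝ, 0 ≤ C ∧ ∀ w : ℂ, w ≠ 0 →
    ‖1 - G w‖ ≤ C * weight ‖w‖ := by
  obtain ⟨C, hC, h⟩ := exists_norm_one_sub_G_le_upper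
  refine ⟨C, hC, fun w hw => ?_⟩
  rcases le_or_gt 0 w.im with him | him
  · exact h w him hw
  · have hs : w ∈ Complex.slitPlane := Complex.mem_slitPlane_iff.2 (Or.inr him.ne)
    have := h (conj w) (by simpa using him.le) (by simpa using hw)
    rw [G_conj hs, Complex.norm_conj] at this
    rwa [← Complex.norm_conj, map_sub, map_one]

theorem exists_abs_rho_le : ∃ C : ℝ, 0 ≤ C ∧ ∀ t : ℝ, 0 < t → |rho t| ≤ C * weight t := by
  obtain ⟨C, hC, h⟩ := exists_norm_one_sub_G_le
  refine ⟨C, hC, fun t ht => ?_⟩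
  have h1 := h (-(t : ℂ)) (by simpa using ht.ne')
  rw [norm_neg, Complex.norm_real, Real.norm_of_nonneg ht.le] at h1
  have h2 := (Complex.abs_im_le_norm _).trans h1
  rw [Complex.sub_im, im_G_neg ht, Complex.one_im, zero_sub, abs_neg, abs_mul,
    abs_of_pos Real.pi_pos] at h2
  nlinarith [abs_nonneg (rho t), Real.pi_gt_three]

/-! ### Measurability, and integrability of `ρ` against the Cauchy kernel -/

theorem measurable_weight : Measurable weight := by unfold weight; fun_prop

theorem measurable_rho : Measurable rho := by
  unfold rho
  refine Measurable.ite (measurableSet_lt measurable_id measurable_const) (by fun_prop) ?_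
  exact Measurable.ite (measurableSet_lt measurable_const measurable_id) (by fun_prop) (by fun_prop)

theorem measurable_G : Measurable G := by unfold G; fun_prop

theorem integrableOn_weight_div_add {a : ℝ} (ha : 0 < a) :
    IntegrableOn (fun t => weight t / (a + t)) (Ioi 0) := by
  have hm : Measurable fun t : ℝ => weight t / (a + t) := by
    have := measurable_weight; fun_prop
  rw [← Ioc_union_Ioi_eq_Ioi zero_le_one]
  refine IntegrableOn.union ?_ ?_
  · have h : IntegrableOn (fun t : ℝ => t ^ (-(1 / 4) : ℝ) / a) (Ioc 0 1) := by
      refine Integrable.div_const ?_ _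
      exact (intervalIntegrable_iff_integrableOn_Ioc_of_le zero_le_one).1
        (intervalIntegral.intervalIntegrable_rpow' (by norm_num))
    refine h.mono' hm.aestronglyMeasurable ?_
    filter_upwards [ae_restrict_mem measurableSet_Ioc] with t ht
    have h0 : 0 < t := ht.1
    rw [Real.norm_of_nonneg (div_nonneg (weight_nonneg h0.le) (by linarith))]
    exact div_le_div₀ (by positivity) (min_le_left _ _) ha (by linarith)
  · have h : IntegrableOn (fun t : ℝ => t ^ (-(7 / 4) : ℝ)) (Ioi 1) :=
      integrableOn_Ioi_rpow_of_lt (by norm_num) one_pos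
    refine h.mono' hm.aestronglyMeasurable ?_
    filter_upwards [ae_restrict_mem measurableSet_Ioi] with t ht
    have h0 : 0 < t := zero_lt_one.trans ht
    rw [Real.norm_of_nonneg (div_nonneg (weight_nonneg h0.le) (by linarith))]
    have e : t ^ (-(7 / 4) : ℝ) = t ^ (-(3 / 4) : ℝ) / t := by
      rw [← Real.rpow_sub_one h0.ne']; norm_num
    rw [e]
    exact div_le_div₀ (by positivity) (min_le_right _ _) h0 (by linarith)

theorem integrableOn_abs_rho_div_add {a : ℝ} (ha : 0 < a) :
    IntegrableOn (fun t => |rho t| / (a + t)) (Ioi 0) := by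
  obtain ⟨C, -, h⟩ := exists_abs_rho_le
  refine ((integrableOn_weight_div_add ha).const_mul C).mono' ?_ ?_
  · have := measurable_rho
    exact Measurable.aestronglyMeasurable (by fun_prop)
  · filter_upwards [ae_restrict_mem measurableSet_Ioi] with t ht
    have h0 : 0 < t := ht
    rw [Real.norm_of_nonneg (by positivity), ← mul_div_assoc]
    gcongr
    exact h t h0

theorem integrableOn_rho_div_add {z : ℂ} (hz : 0 < z.re) :
    IntegrableOn (fun t : ℝ => (rho t : ℂ) / (z + t)) (Ioi 0) := by
  refine (integrableOn_abs_rho_div_add hz).mono' ?_ ?_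
  · have := measurable_rho
    exact Measurable.aestronglyMeasurable (by fun_prop)
  · filter_upwards [ae_restrict_mem measurableSet_Ioi] with t ht
    have h0 : 0 < t := ht
    rw [norm_div, Complex.norm_real, Real.norm_eq_abs]
    gcongr
    simpa using Complex.re_le_norm (z + t)

/-! ### Cauchy's formula in logarithmic coordinates -/

/-- The function `1 - G (exp ζ)` on the strip `|Im ζ| < π`, extended continuously to both boundary
lines. -/
noncomputable def stripFun (ζ : ℂ) : ℂ :=
  if 0 ≤ ζ.im then 1 - G (Complex.exp ζ) else conj (1 - G (Complex.exp (conj ζ)))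

theorem exp_mem_slitPlane_of_abs_im_lt {ζ : ℂ} (h : |ζ.im| < Real.pi) :
    Complex.exp ζ ∈ Complex.slitPlane := by
  obtain ⟨h1, h2⟩ := abs_lt.1 h
  rw [Complex.mem_slitPlane_iff, Complex.exp_re, Complex.exp_im]
  rcases eq_or_ne ζ.im 0 with h0 | h0
  · left; rw [h0]; simp [Real.exp_pos]
  · right
    refine mul_ne_zero (Real.exp_ne_zero _) fun hs => h0 ?_
    rwa [Real.sin_eq_zero_iff_of_lt_of_lt h1 h2] at hs

theorem stripFun_of_abs_im_lt {ζ : ℂ} (h : |ζ.im| < Real.pi) :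
    stripFun ζ = 1 - G (Complex.exp ζ) := by
  unfold stripFun
  split_ifs
  · rfl
  · rw [Complex.exp_conj, G_conj (exp_mem_slitPlane_of_abs_im_lt h)]
    simp

theorem differentiableAt_stripFun {ζ : ℂ} (h : |ζ.im| < Real.pi) :
    DifferentiableAt ℂ stripFun ζ := by
  have h1 : DifferentiableAt ℂ (fun ζ => 1 - G (Complex.exp ζ)) ζ :=
    (differentiableAt_const _).sub
      ((differentiableAt_G (exp_mem_slitPlane_of_abs_im_lt h)).comp ζ Complex.differentiableAt_exp)
  refine h1.congr_of_eventuallyEq ?_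
  filter_upwards [(isOpen_lt (continuous_abs.comp Complex.continuous_im)
    continuous_const).mem_nhds h] with w hw
  exact stripFun_of_abs_im_lt hw

theorem exp_im_nonneg {ζ : ℂ} (h0 : 0 ≤ ζ.im) (h1 : ζ.im ≤ Real.pi) :
    0 ≤ (Complex.exp ζ).im := by
  rw [Complex.exp_im]
  exact mul_nonneg (Real.exp_pos _).le (Real.sin_nonneg_of_nonneg_of_le_pi h0 h1)

theorem continuousOn_stripFun : ContinuousOn stripFun {ζ : ℂ | |ζ.im| ≤ Real.pi} := by
  have hu : {ζ : ℂ | |ζ.im| ≤ Real.pi} =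
      {ζ : ℂ | 0 ≤ ζ.im ∧ ζ.im ≤ Real.pi} ∪ {ζ : ℂ | ζ.im ≤ 0 ∧ -Real.pi ≤ ζ.im} := by
    ext ζ
    simp only [mem_ofPred_eq, mem_union, abs_le]
    have := Real.pi_pos
    constructor
    · rintro ⟨h1, h2⟩
      rcases le_total 0 ζ.im with h | h
      · exact Or.inl ⟨h, h2⟩
      · exact Or.inr ⟨h, h1⟩
    · rintro (⟨h1, h2⟩ | ⟨h1, h2⟩) <;> constructor <;> linarith
  have hc : ContinuousOn (fun ζ => 1 - G (Complex.exp ζ)) {ζ : ℂ | 0 ≤ ζ.im ∧ ζ.im ≤ Real.pi} :=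
    continuousOn_const.sub (continuousOn_G.comp Complex.continuous_exp.continuousOn
      fun ζ hζ => ⟨exp_im_nonneg hζ.1 hζ.2, Complex.exp_ne_zero _⟩)
  rw [hu]
  refine ContinuousOn.union_of_isClosed ?_ ?_ ?_ ?_
  · exact hc.congr fun ζ hζ => if_pos hζ.1
  · have hc' : ContinuousOn (fun ζ => conj (1 - G (Complex.exp (conj ζ))))
        {ζ : ℂ | ζ.im ≤ 0 ∧ -Real.pi ≤ ζ.im} :=
      Complex.continuous_conj.comp_continuousOn
        (hc.comp (f := fun ζ => conj ζ) Complex.continuous_conj.continuousOn fun ζ hζ => by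
          constructor
          · simpa using hζ.1
          · simpa [neg_le] using hζ.2)
    refine hc'.congr fun ζ hζ => ?_
    by_cases h : 0 ≤ ζ.im
    · have h0 : ζ.im = 0 := le_antisymm hζ.1 h
      have h1 : |ζ.im| < Real.pi := by rw [h0, abs_zero]; exact Real.pi_pos
      simp only
      rw [stripFun_of_abs_im_lt h1, Complex.exp_conj, G_conj (exp_mem_slitPlane_of_abs_im_lt h1)]
      simp
    · exact if_neg h
  · exact (isClosed_le continuous_const Complex.continuous_im).inter
      (isClosed_le Complex.continuous_im continuous_const)
  · exact (isClosed_le Complex.continuous_im continuous_const).inter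
      (isClosed_le continuous_const Complex.continuous_im)

theorem exists_norm_stripFun_le : ∃ C : ℝ, 0 ≤ C ∧ ∀ ζ : ℂ,
    ‖stripFun ζ‖ ≤ C * Real.exp (-(1 / 4 * ζ.re)) := by
  obtain ⟨C, hC, h⟩ := exists_norm_one_sub_G_le
  have h' (ζ : ℂ) : ‖1 - G (Complex.exp ζ)‖ ≤ C * Real.exp (-(1 / 4 * ζ.re)) := by
    refine (h _ (Complex.exp_ne_zero ζ)).trans ?_
    gcongr
    refine (min_le_left _ _).trans_eq ?_
    rw [Complex.norm_exp, ← Real.exp_mul]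
    ring_nf
  refine ⟨C, hC, fun ζ => ?_⟩
  unfold stripFun
  split_ifs
  · exact h' ζ
  · rw [Complex.norm_conj]
    simpa using h' (conj ζ)

theorem exp_add_pi_mul_I (x : ℝ) :
    Complex.exp (x + Real.pi * Complex.I) = -((Real.exp x : ℝ) : ℂ) := by
  rw [Complex.exp_add, Complex.exp_pi_mul_I]; simp

theorem exp_sub_pi_mul_I (x : ℝ) :
    Complex.exp (x + (-Real.pi : ℝ) * Complex.I) = -((Real.exp x : ℝ) : ℂ) := by
  rw [← exp_add_pi_mul_I, Complex.exp_eq_exp_iff_exists_int]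
  exact ⟨-1, by push_cast; ring⟩

/-- The jump of `stripFun` between the two boundary lines is given by the density `rho`. -/
theorem stripFun_jump (x : ℝ) :
    stripFun (x + (-Real.pi : ℝ) * Complex.I) - stripFun (x + Real.pi * Complex.I) =
      2 * Real.pi * Complex.I * rho (Real.exp x) := by
  have hpi := Real.pi_pos
  have e1 : stripFun (x + (-Real.pi : ℝ) * Complex.I) =
      conj (1 - G (-((Real.exp x : ℝ) : ℂ))) := by
    rw [stripFun, if_neg (by simpa using hpi), ← exp_add_pi_mul_I]
    simp
  have e2 : stripFun (x + Real.pi * Complex.I) = 1 - G (-((Real.exp x : ℝ) : ℂ)) := by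
    rw [stripFun, if_pos (by simpa using hpi.le), exp_add_pi_mul_I]
  have h := im_G_neg (Real.exp_pos x)
  rw [e1, e2]
  apply Complex.ext
  · simp
  · simp only [Complex.sub_im, Complex.conj_im, Complex.one_im, h]
    simp
    ring

/-- The imaginary parts differ by less than `2π`, which rules out a nonzero period. -/
theorem exp_ne_exp_of_abs_im {ζ ζ₀ : ℂ} (h : |ζ.im| ≤ Real.pi) (h₀ : |ζ₀.im| < Real.pi)
    (hne : ζ ≠ ζ₀) : Complex.exp ζ ≠ Complex.exp ζ₀ := by
  intro he
  obtain ⟨n, hn⟩ := Complex.exp_eq_exp_iff_exists_int.1 he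
  have him : ζ.im - ζ₀.im = n * (2 * Real.pi) := by
    rw [hn]; simp
  obtain ⟨h1, h2⟩ := abs_le.1 h
  obtain ⟨h3, h4⟩ := abs_lt.1 h₀
  have hpi := Real.pi_pos
  have n1 : (n : ℝ) < 1 := by nlinarith
  have n2 : (-1 : ℝ) < n := by nlinarith
  have n1' : n < 1 := by exact_mod_cast n1
  have n2' : -1 < n := by exact_mod_cast n2
  have : n = 0 := by omega
  apply hne
  rw [hn, this]; simp

/-- The integrand of Cauchy's formula in logarithmic coordinates, with its singularity at `ζ₀`
removed. -/
noncomputable def stripIntegrand (ζ₀ ζ : ℂ) : ℂ :=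
  dslope stripFun ζ₀ ζ * Complex.exp ζ / dslope Complex.exp ζ₀ ζ

theorem stripIntegrand_of_ne {ζ₀ ζ : ℂ} (h : ζ ≠ ζ₀) :
    stripIntegrand ζ₀ ζ = (stripFun ζ - stripFun ζ₀) *
      (Complex.exp ζ / (Complex.exp ζ - Complex.exp ζ₀)) := by
  have : ζ - ζ₀ ≠ 0 := sub_ne_zero.2 h
  rw [stripIntegrand, dslope_of_ne _ h, dslope_of_ne _ h, slope_def_field, slope_def_field]
  field_simp

theorem dslope_exp_ne_zero {ζ₀ ζ : ℂ} (h₀ : |ζ₀.im| < Real.pi) (h : |ζ.im| ≤ Real.pi) :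
    dslope Complex.exp ζ₀ ζ ≠ 0 := by
  rcases eq_or_ne ζ ζ₀ with rfl | hne
  · simp
  · rw [dslope_of_ne _ hne, slope_def_field]
    exact div_ne_zero (sub_ne_zero.2 (exp_ne_exp_of_abs_im h h₀ hne)) (sub_ne_zero.2 hne)

theorem continuousOn_stripIntegrand {ζ₀ : ℂ} (h₀ : |ζ₀.im| < Real.pi) :
    ContinuousOn (stripIntegrand ζ₀) {ζ : ℂ | |ζ.im| ≤ Real.pi} := by
  have hn : {ζ : ℂ | |ζ.im| ≤ Real.pi} ∈ 𝓝 ζ₀ := by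
    filter_upwards [(isOpen_lt (continuous_abs.comp Complex.continuous_im)
      continuous_const).mem_nhds h₀] with w hw
    exact le_of_lt hw
  have h1 : ContinuousOn (dslope stripFun ζ₀) {ζ : ℂ | |ζ.im| ≤ Real.pi} :=
    (continuousOn_dslope hn).2 ⟨continuousOn_stripFun, differentiableAt_stripFun h₀⟩
  have h2 : ContinuousOn (dslope Complex.exp ζ₀) {ζ : ℂ | |ζ.im| ≤ Real.pi} :=
    (continuousOn_dslope hn).2 ⟨Complex.continuous_exp.continuousOn, Complex.differentiableAt_exp⟩
  exact (h1.mul Complex.continuous_exp.continuousOn).div h2 fun ζ hζ => dslope_exp_ne_zero h₀ hζ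

theorem differentiableAt_stripIntegrand {ζ₀ ζ : ℂ} (h₀ : |ζ₀.im| < Real.pi)
    (h : |ζ.im| < Real.pi) (hne : ζ ≠ ζ₀) : DifferentiableAt ℂ (stripIntegrand ζ₀) ζ :=
  (((differentiableAt_dslope_of_ne hne).2 (differentiableAt_stripFun h)).mul
    Complex.differentiableAt_exp).div
      ((differentiableAt_dslope_of_ne hne).2 Complex.differentiableAt_exp)
      (dslope_exp_ne_zero h₀ h.le)

theorem tendsto_intervalIntegral_of_norm_sub_le {f : ℝ → ℝ → ℂ} {a b : ℝ} {c : ℂ} {e : ℝ → ℝ}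
    (he : Tendsto e atTop (𝓝 0)) (hf : ∀ R, IntervalIntegrable (f R) volume a b)
    (h : ∀ᶠ R in atTop, ∀ y ∈ uIoc a b, ‖f R y - c‖ ≤ e R) :
    Tendsto (fun R => ∫ y in a..b, f R y) atTop (𝓝 ((b - a) • c)) := by
  rw [tendsto_iff_norm_sub_tendsto_zero]
  refine squeeze_zero' (.of_forall fun _ => norm_nonneg _) ?_
    (by simpa using he.mul_const |b - a|)
  filter_upwards [h] with R hR
  rw [← intervalIntegral.integral_const, ← intervalIntegral.integral_sub (hf R) (by simp)]
  exact intervalIntegral.norm_integral_le_of_norm_le_const hR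

theorem tendsto_exp_neg_mul_atTop {c : ℝ} (hc : 0 < c) :
    Tendsto (fun R : ℝ => Real.exp (-(c * R))) atTop (𝓝 0) :=
  Real.tendsto_exp_neg_atTop_nhds_zero.comp (tendsto_id.const_mul_atTop hc)

theorem intervalIntegrable_stripIntegrand_vertical {ζ₀ : ℂ} (h₀ : |ζ₀.im| < Real.pi) (R : ℝ) :
    IntervalIntegrable (fun y : ℝ => stripIntegrand ζ₀ (R + y * Complex.I)) volume
      (-Real.pi) Real.pi := by
  refine ContinuousOn.intervalIntegrable ?_
  refine (continuousOn_stripIntegrand h₀).comp (by fun_prop) fun y hy => ?_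
  rw [uIcc_of_le (by linarith [Real.pi_pos])] at hy
  simpa [abs_le] using hy

/-- As `Re ζ → ∞`, `stripFun ζ` decays and the kernel `e^ζ / (e^ζ - e^{ζ₀})` tends to `1`, so only
the subtracted constant survives. -/
theorem tendsto_integral_right {ζ₀ : ℂ} (h₀ : |ζ₀.im| < Real.pi) :
    Tendsto (fun R : ℝ => ∫ y in (-Real.pi)..Real.pi,
      stripIntegrand ζ₀ ((R : ℂ) + y * Complex.I)) atTop
      (𝓝 ((Real.pi - -Real.pi) • (-stripFun ζ₀))) := by
  obtain ⟨C, hC, hF⟩ := exists_norm_stripFun_le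
  set z := Complex.exp ζ₀
  refine tendsto_intervalIntegral_of_norm_sub_le
    (e := fun R => C * Real.exp (-(1 / 4 * R)) * 2 +
      ‖stripFun ζ₀‖ * (2 * ‖z‖ * Real.exp (-(1 * R)))) ?_
    (intervalIntegrable_stripIntegrand_vertical h₀) ?_
  · have h1 := ((tendsto_exp_neg_mul_atTop (c := 1 / 4) (by norm_num)).const_mul C).mul_const 2
    have h2 := ((tendsto_exp_neg_mul_atTop (c := 1) (by norm_num)).const_mul
      (2 * ‖z‖)).const_mul ‖stripFun ζ₀‖
    simpa using h1.add h2
  · filter_upwards [Real.tendsto_exp_atTop.eventually_ge_atTop (2 * ‖z‖),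
      eventually_gt_atTop ζ₀.re] with R hR hR' y _
    have hne : (R : ℂ) + y * Complex.I ≠ ζ₀ := by
      rintro rfl; simp at hR'
    rw [stripIntegrand_of_ne hne]
    set ζ := (R : ℂ) + y * Complex.I with hζ
    have hre : ζ.re = R := by simp [hζ]
    have hn : ‖Complex.exp ζ‖ = Real.exp R := by rw [Complex.norm_exp, hre]
    have hE := Real.exp_pos R
    have hlow : Real.exp R / 2 ≤ ‖Complex.exp ζ - z‖ := by
      have := norm_sub_norm_le (Complex.exp ζ) z
      rw [hn] at this; linarith
    have hz0 : Complex.exp ζ - z ≠ 0 := by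
      intro h; rw [h, norm_zero] at hlow; linarith
    have hk : ‖Complex.exp ζ / (Complex.exp ζ - z)‖ ≤ 2 := by
      rw [norm_div, hn, div_le_iff₀ (by linarith)]; linarith
    have hk' : ‖z / (Complex.exp ζ - z)‖ ≤ 2 * ‖z‖ * Real.exp (-(1 * R)) := by
      rw [norm_div, div_le_iff₀ (by linarith), one_mul, Real.exp_neg]
      calc ‖z‖ = 2 * ‖z‖ * (Real.exp R)⁻¹ * (Real.exp R / 2) := by field_simp
        _ ≤ _ := by gcongr
    have e : (stripFun ζ - stripFun ζ₀) * (Complex.exp ζ / (Complex.exp ζ - z)) - -stripFun ζ₀ =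
        stripFun ζ * (Complex.exp ζ / (Complex.exp ζ - z)) -
          stripFun ζ₀ * (z / (Complex.exp ζ - z)) := by field_simp; ring
    rw [e]
    refine (norm_sub_le _ _).trans ?_
    rw [norm_mul, norm_mul]
    have := hF ζ
    rw [hre] at this
    gcongr

/-- As `Re ζ = -R → -∞`, the kernel is `O(e^{-R})`, which beats the growth `e^{R/4}` of `stripFun`.
-/
theorem tendsto_integral_left {ζ₀ : ℂ} (h₀ : |ζ₀.im| < Real.pi) :
    Tendsto (fun R : ℝ => ∫ y in (-Real.pi)..Real.pi,
      stripIntegrand ζ₀ (((-R : ℝ) : ℂ) + y * Complex.I)) atTop (𝓝 0) := by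
  obtain ⟨C, hC, hF⟩ := exists_norm_stripFun_le
  set z := Complex.exp ζ₀ with hz
  have hzp : 0 < ‖z‖ := norm_pos_iff.2 (Complex.exp_ne_zero _)
  rw [show (0 : ℂ) = (Real.pi - -Real.pi) • (0 : ℂ) by simp]
  refine tendsto_intervalIntegral_of_norm_sub_le
    (e := fun R => 2 * C / ‖z‖ * Real.exp (-(3 / 4 * R)) +
      2 * ‖stripFun ζ₀‖ / ‖z‖ * Real.exp (-(1 * R))) ?_
    (fun R => intervalIntegrable_stripIntegrand_vertical h₀ (-R)) ?_
  · have h1 := (tendsto_exp_neg_mul_atTop (c := 3 / 4) (by norm_num)).const_mul (2 * C / ‖z‖)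
    have h2 := (tendsto_exp_neg_mul_atTop (c := 1) (by norm_num)).const_mul
      (2 * ‖stripFun ζ₀‖ / ‖z‖)
    simpa using h1.add h2
  · filter_upwards [(tendsto_exp_neg_mul_atTop (c := 1) one_pos).eventually_le_const
      (half_pos hzp), eventually_gt_atTop (-ζ₀.re)] with R hR hR' y _
    have hne : ((-R : ℝ) : ℂ) + y * Complex.I ≠ ζ₀ := by
      rintro rfl; simp at hR'
    rw [stripIntegrand_of_ne hne, sub_zero]
    set ζ := ((-R : ℝ) : ℂ) + y * Complex.I with hζ
    have hre : ζ.re = -R := by simp [hζ]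
    have hn : ‖Complex.exp ζ‖ = Real.exp (-(1 * R)) := by rw [Complex.norm_exp, hre, one_mul]
    have hlow : ‖z‖ / 2 ≤ ‖Complex.exp ζ - z‖ := by
      have := norm_sub_norm_le z (Complex.exp ζ)
      rw [hn, norm_sub_rev] at this; linarith
    have hk : ‖Complex.exp ζ / (Complex.exp ζ - z)‖ ≤ 2 / ‖z‖ * Real.exp (-(1 * R)) := by
      rw [norm_div, hn, div_le_iff₀ (by linarith)]
      calc Real.exp (-(1 * R)) = 2 / ‖z‖ * Real.exp (-(1 * R)) * (‖z‖ / 2) := by field_simp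
        _ ≤ _ := by gcongr
    have h1 := hF ζ
    rw [hre] at h1
    rw [norm_mul]
    calc _ ≤ (C * Real.exp (-(1 / 4 * -R)) + ‖stripFun ζ₀‖) *
          (2 / ‖z‖ * Real.exp (-(1 * R))) := by
          gcongr
          exact (norm_sub_le _ _).trans (by gcongr)
      _ = 2 * C / ‖z‖ * (Real.exp (-(1 / 4 * -R)) * Real.exp (-(1 * R))) +
          2 * ‖stripFun ζ₀‖ / ‖z‖ * Real.exp (-(1 * R)) := by ring
      _ = _ := by rw [← Real.exp_add]; ring_nf

/-- The exponential takes the same values on the two horizontal sides of the rectangle. The kernel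
is therefore common to both, the subtracted constant cancels, and only the jump remains. -/
theorem integral_rho_comp_exp_eq {ζ₀ : ℂ} (h₀ : |ζ₀.im| < Real.pi) (R : ℝ) :
    2 * Real.pi * Complex.I * (∫ x in (-R)..R, Real.exp x • ((rho (Real.exp x) : ℂ) /
        (Complex.exp ζ₀ + (Real.exp x : ℝ)))) +
      Complex.I * (∫ y in (-Real.pi)..Real.pi, stripIntegrand ζ₀ ((R : ℂ) + y * Complex.I)) -
      Complex.I * (∫ y in (-Real.pi)..Real.pi,
        stripIntegrand ζ₀ (((-R : ℝ) : ℂ) + y * Complex.I)) = 0 := by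
  have hpi := Real.pi_pos
  -- At the exceptional point `ζ₀` continuity suffices, so no holomorphic extension across the
  -- removed singularity is needed.
  have h := Complex.integral_boundary_rect_eq_zero_of_differentiable_on_off_countable
    (stripIntegrand ζ₀) ⟨-R, -Real.pi⟩ ⟨R, Real.pi⟩ {ζ₀} (countable_singleton _)
    ((continuousOn_stripIntegrand h₀).mono fun ζ hζ => by
      have := (Complex.mem_reProdIm.1 hζ).2
      rw [uIcc_of_le (by simp; linarith)] at this
      simpa [abs_le] using this)
    (fun ζ hζ => by
      have := (Complex.mem_reProdIm.1 hζ.1).2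
      rw [min_eq_left (by simp; linarith), max_eq_right (by simp; linarith)] at this
      exact differentiableAt_stripIntegrand h₀ (by simpa [abs_lt] using this) hζ.2)
  simp only [smul_eq_mul] at h
  have hint (b : ℝ) (hb : |b| ≤ Real.pi) :
      IntervalIntegrable (fun x : ℝ => stripIntegrand ζ₀ (x + b * Complex.I)) volume (-R) R := by
    refine ContinuousOn.intervalIntegrable ?_
    refine (continuousOn_stripIntegrand h₀).comp (by fun_prop) fun x hx => ?_
    simpa using hb
  rw [← intervalIntegral.integral_sub (hint _ (by simp [abs_of_pos hpi]))
    (hint _ (by simp [abs_of_pos hpi]))] at h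
  refine Eq.trans ?_ h
  rw [← intervalIntegral.integral_const_mul]
  refine congrArg₂ _ (congrArg₂ _ (intervalIntegral.integral_congr fun x _ => ?_) rfl) rfl
  have hne (b : ℝ) (hb : |b| = Real.pi) : (x : ℂ) + b * Complex.I ≠ ζ₀ := by
    rintro rfl
    simp [hb] at h₀
  rw [stripIntegrand_of_ne (hne _ (by simp [abs_of_pos hpi])),
    stripIntegrand_of_ne (hne _ (abs_of_pos hpi)), exp_add_pi_mul_I, exp_sub_pi_mul_I, ← sub_mul,
    sub_sub_sub_cancel_right, stripFun_jump, ← neg_add', neg_div_neg_eq, Complex.real_smul,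
    add_comm (Complex.exp ζ₀)]
  ring

/-- The Stieltjes representation of `1 - G`. -/
theorem one_sub_G_eq_integral {z : ℂ} (hz : 0 < z.re) :
    1 - G z = ∫ t in Ioi (0 : ℝ), (rho t : ℂ) / (z + t) := by
  have hpi := Real.pi_pos
  have hz0 : z ≠ 0 := by rintro rfl; simp at hz
  set ζ₀ := Complex.log z with hζ
  have hexp : Complex.exp ζ₀ = z := Complex.exp_log hz0
  have h₀ : |ζ₀.im| < Real.pi := by
    rw [hζ, Complex.log_im]
    have := Complex.abs_arg_le_pi_div_two_iff.2 hz.le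
    linarith
  have himg : Real.exp '' univ = Ioi 0 := by rw [image_univ, Real.range_exp]
  -- The substitution `t = e^x` matches the Stieltjes integral with the horizontal sides.
  have hchange := integral_image_eq_integral_abs_deriv_smul MeasurableSet.univ
    (fun x _ => (Real.hasDerivAt_exp x).hasDerivWithinAt) Real.exp_injective.injOn
    (fun t : ℝ => (rho t : ℂ) / (z + t))
  have hint := (integrableOn_image_iff_integrableOn_abs_deriv_smul MeasurableSet.univ
    (fun x _ => (Real.hasDerivAt_exp x).hasDerivWithinAt) Real.exp_injective.injOn
    (fun t : ℝ => (rho t : ℂ) / (z + t))).1 (by rw [himg]; exact integrableOn_rho_div_add hz)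
  simp only [himg, abs_of_pos (Real.exp_pos _), Measure.restrict_univ, integrableOn_univ]
    at hchange hint
  have hlim := intervalIntegral_tendsto_integral hint tendsto_neg_atTop_atBot tendsto_id
  have h1 := ((hlim.const_mul (2 * Real.pi * Complex.I)).add
    ((tendsto_integral_right h₀).const_mul Complex.I)).sub
      ((tendsto_integral_left h₀).const_mul Complex.I)
  have h2 := tendsto_nhds_unique h1 ((tendsto_const_nhds (x := (0 : ℂ))).congr fun R => by
    have := integral_rho_comp_exp_eq h₀ R
    rw [hexp] at this
    exact this.symm)
  rw [stripFun_of_abs_im_lt h₀, hexp] at h2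
  rw [hchange]
  have h3 : (2 * Real.pi * Complex.I : ℂ) ≠ 0 := Complex.two_pi_I_ne_zero
  refine mul_left_cancel₀ h3 ?_
  rw [Complex.real_smul] at h2
  push_cast at h2 ⊢
  linear_combination -h2

/-! ### Square integrability of the weight and of `φ` -/

theorem integrableOn_weight_sq : IntegrableOn (fun t => weight t ^ 2) (Ioi 0) := by
  have hm : Measurable fun t => weight t ^ 2 := measurable_weight.pow_const 2
  rw [← Ioc_union_Ioi_eq_Ioi zero_le_one]
  refine IntegrableOn.union ?_ ?_
  · have h : IntegrableOn (fun t : ℝ => t ^ (-(1 / 2) : ℝ)) (Ioc 0 1) :=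
      (intervalIntegrable_iff_integrableOn_Ioc_of_le zero_le_one).1
        (intervalIntegral.intervalIntegrable_rpow' (by norm_num))
    refine h.mono' hm.aestronglyMeasurable ?_
    filter_upwards [ae_restrict_mem measurableSet_Ioc] with t ht
    have h0 : 0 < t := ht.1
    rw [Real.norm_of_nonneg (by positivity)]
    calc weight t ^ 2 ≤ (t ^ (-(1 / 4) : ℝ)) ^ 2 :=
          pow_le_pow_left₀ (weight_nonneg h0.le) (min_le_left _ _) 2
      _ = _ := by rw [← Real.rpow_natCast, ← Real.rpow_mul h0.le]; norm_num
  · have h : IntegrableOn (fun t : ℝ => t ^ (-(3 / 2) : ℝ)) (Ioi 1) :=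
      integrableOn_Ioi_rpow_of_lt (by norm_num) one_pos
    refine h.mono' hm.aestronglyMeasurable ?_
    filter_upwards [ae_restrict_mem measurableSet_Ioi] with t ht
    have h0 : 0 < t := zero_lt_one.trans ht
    rw [Real.norm_of_nonneg (by positivity)]
    calc weight t ^ 2 ≤ (t ^ (-(3 / 4) : ℝ)) ^ 2 :=
          pow_le_pow_left₀ (weight_nonneg h0.le) (min_le_right _ _) 2
      _ = _ := by rw [← Real.rpow_natCast, ← Real.rpow_mul h0.le]; norm_num

theorem memLp_weight : MemLp weight 2 (volume.restrict (Ioi 0)) :=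
  (memLp_two_iff_integrable_sq measurable_weight.aestronglyMeasurable).2 integrableOn_weight_sq

theorem measurable_weight_abs : Measurable fun t : ℝ => weight |t| :=
  measurable_weight.comp measurable_norm

theorem memLp_weight_abs : MemLp (fun t : ℝ => weight |t|) 2 volume := by
  refine (memLp_two_iff_integrable_sq measurable_weight_abs.aestronglyMeasurable).2 ?_
  have h1 : IntegrableOn (fun t : ℝ => weight |t| ^ 2) (Ioi 0) :=
    integrableOn_weight_sq.congr_fun
      (fun t (ht : 0 < t) => by simp only [abs_of_pos ht]) measurableSet_Ioi
  have h2 : IntegrableOn (fun t : ℝ => weight |t| ^ 2) (Iio 0) := by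
    have := (Measure.measurePreserving_neg (volume : Measure ℝ)).integrableOn_comp_preimage
      (Homeomorph.neg ℝ).measurableEmbedding (f := fun t : ℝ => weight |t| ^ 2) (s := Ioi 0)
    simpa [Function.comp_def] using this.2 h1
  rw [← integrableOn_univ, ← Iic_union_Ioi (a := (0 : ℝ))]
  exact ((integrableOn_Iic_iff_integrableOn_Iio (by simp)).2 h2).union h1

theorem measurable_phi : Measurable phi := by
  have h : Measurable (Function.uncurry fun s t : ℝ => Real.exp (-(s * t)) * rho t) := by
    have := measurable_rho
    unfold Function.uncurry
    fun_prop
  exact h.stronglyMeasurable.integral_prod_right.measurable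

theorem abs_phi_le_of_abs_rho_le {C p s : ℝ} (hp : 0 < p) (hs : 0 < s)
    (h : ∀ t : ℝ, 0 < t → |rho t| ≤ C * t ^ (p - 1)) :
    |phi s| ≤ C * Real.Gamma p * s ^ (-p) := by
  have e : C * Real.Gamma p * s ^ (-p) =
      ∫ t in Ioi (0 : ℝ), C * (t ^ (p - 1) * Real.exp (-(s * t))) := by
    rw [integral_const_mul, Real.integral_rpow_mul_exp_neg_mul_Ioi hp hs, one_div,
      Real.inv_rpow hs.le, Real.rpow_neg hs.le]
    ring
  rw [e, ← Real.norm_eq_abs]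
  refine norm_integral_le_of_norm_le (Integrable.const_mul ?_ _) ?_
  · have := integrableOn_rpow_mul_exp_neg_mul_rpow (p := 1) (s := p - 1) (b := s)
      (by linarith) one_pos hs
    simpa [IntegrableOn] using this
  · filter_upwards [ae_restrict_mem measurableSet_Ioi] with t ht
    rw [norm_mul, Real.norm_of_nonneg (Real.exp_pos _).le, Real.norm_eq_abs]
    calc _ ≤ Real.exp (-(s * t)) * (C * t ^ (p - 1)) := by gcongr; exact h t ht
      _ = _ := by ring

/-- The Laplace transform takes `t^(p-1)` to a multiple of `s^(-p)`. It thus exchanges the powers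
`-1/4` and `-3/4`, and the weight reproduces itself. -/
theorem exists_abs_phi_le : ∃ C : ℝ, ∀ s : ℝ, 0 < s → |phi s| ≤ C * weight s := by
  obtain ⟨C, hC, h⟩ := exists_abs_rho_le
  refine ⟨C * Real.Gamma (1 / 4) + C * Real.Gamma (3 / 4), fun s hs => ?_⟩
  have h1 := abs_phi_le_of_abs_rho_le (C := C) (p := 1 / 4) (by norm_num) hs fun t ht =>
    (h t ht).trans (by gcongr; norm_num; exact min_le_right _ _)
  have h2 := abs_phi_le_of_abs_rho_le (C := C) (p := 3 / 4) (by norm_num) hs fun t ht =>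
    (h t ht).trans (by gcongr; norm_num; exact min_le_left _ _)
  have g1 : 0 ≤ C * Real.Gamma (1 / 4) := mul_nonneg hC (Real.Gamma_pos_of_pos (by norm_num)).le
  have g2 : 0 ≤ C * Real.Gamma (3 / 4) := mul_nonneg hC (Real.Gamma_pos_of_pos (by norm_num)).le
  unfold weight
  rw [mul_min_of_nonneg _ _ (add_nonneg g1 g2)]
  refine le_min (h1.trans ?_) (h2.trans ?_) <;> gcongr <;> linarith

theorem memLp_phi : MemLp phi 2 (volume.restrict (Ioi 0)) := by
  obtain ⟨C, h⟩ := exists_abs_phi_le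
  refine (memLp_weight.const_mul C).mono' measurable_phi.aestronglyMeasurable ?_
  filter_upwards [ae_restrict_mem measurableSet_Ioi] with s hs
  exact h s hs

/-! ### Laplace representation and vertical lines -/

/-- Fubini applied to `e^{-(z+t)s} ρ(t)`; absolute convergence reduces to that of `∫ |ρ(t)| / (Re z
+ t) dt`. -/
theorem integral_exp_mul_phi {z : ℂ} (hz : 0 < z.re) :
    ∫ s in Ioi (0 : ℝ), Complex.exp (-(z * s)) * phi s = 1 - G z := by
  have hmeas : Measurable (Function.uncurry fun s t : ℝ =>
      Complex.exp (-(z * s)) * ((Real.exp (-(s * t)) * rho t : ℝ) : ℂ)) := by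
    have := measurable_rho
    unfold Function.uncurry
    fun_prop
  have hre (t : ℝ) (ht : 0 < t) : (-(z + t)).re < 0 := by simp; linarith
  have heq (s t : ℝ) : Complex.exp (-(z * s)) * ((Real.exp (-(s * t)) * rho t : ℝ) : ℂ) =
      Complex.exp (-(z + t) * s) * rho t := by
    push_cast
    rw [← mul_assoc, ← Complex.exp_add]
    ring_nf
  have hnorm (s t : ℝ) : ‖Complex.exp (-(z + t) * s) * rho t‖ =
      Real.exp (-(z.re + t) * s) * |rho t| := by
    rw [norm_mul, Complex.norm_exp, Complex.norm_real, Real.norm_eq_abs]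
    simp
  have hint : Integrable (Function.uncurry fun s t : ℝ =>
      Complex.exp (-(z * s)) * ((Real.exp (-(s * t)) * rho t : ℝ) : ℂ))
      ((volume.restrict (Ioi 0)).prod (volume.restrict (Ioi 0))) := by
    refine (integrable_prod_iff' hmeas.aestronglyMeasurable).2 ⟨?_, ?_⟩
    · filter_upwards [ae_restrict_mem measurableSet_Ioi] with t ht
      simp only [Function.uncurry, heq]
      exact (integrableOn_exp_mul_complex_Ioi (hre t ht) 0).mul_const _
    · refine (integrableOn_abs_rho_div_add hz).congr ?_
      filter_upwards [ae_restrict_mem measurableSet_Ioi] with t ht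
      have ht' : -(z.re + t) < 0 := by have : 0 < t := ht; linarith
      simp only [Function.uncurry, heq, hnorm]
      rw [integral_mul_const, integral_exp_mul_Ioi ht']
      simp only [mul_zero, Real.exp_zero, neg_div_neg_eq]
      ring
  rw [one_sub_G_eq_integral hz]
  calc _ = ∫ s in Ioi (0 : ℝ), ∫ t in Ioi (0 : ℝ),
        Complex.exp (-(z * s)) * ((Real.exp (-(s * t)) * rho t : ℝ) : ℂ) := by
        congr with s
        rw [integral_const_mul, integral_complex_ofReal, phi]
    _ = ∫ t in Ioi (0 : ℝ), ∫ s in Ioi (0 : ℝ),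
        Complex.exp (-(z * s)) * ((Real.exp (-(s * t)) * rho t : ℝ) : ℂ) :=
        integral_integral_swap hint
    _ = _ := by
        refine setIntegral_congr_fun measurableSet_Ioi fun t ht => ?_
        simp only [heq]
        rw [integral_mul_const, integral_exp_mul_complex_Ioi (hre t ht)]
        simp only [Complex.ofReal_zero, mul_zero, Complex.exp_zero, neg_div_neg_eq]
        ring

/-- Since `|a + it| ≥ |t|` and the weight is decreasing, one majorant serves every `a`. -/
theorem exists_norm_one_sub_G_vertical_le : ∃ C : ℝ, ∀ a t : ℝ, t ≠ 0 →
    ‖1 - G ((a : ℂ) + Complex.I * t)‖ ≤ C * weight |t| := by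
  obtain ⟨C, hC, h⟩ := exists_norm_one_sub_G_le
  refine ⟨C, fun a t ht => ?_⟩
  have h1 : |t| ≤ ‖(a : ℂ) + Complex.I * t‖ := by
    simpa using Complex.abs_im_le_norm ((a : ℂ) + Complex.I * t)
  have h2 : 0 < |t| := abs_pos.2 ht
  refine (h _ (norm_pos_iff.1 (h2.trans_le h1))).trans ?_
  gcongr
  exact weight_anti h2 h1

theorem measurable_one_sub_G_vertical (a : ℝ) :
    Measurable fun t : ℝ => 1 - G ((a : ℂ) + Complex.I * t) := by
  have := measurable_G
  fun_prop

theorem memLp_one_sub_G_vertical (a : ℝ) :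
    MemLp (fun t : ℝ => 1 - G ((a : ℂ) + Complex.I * t)) 2 volume := by
  obtain ⟨C, h⟩ := exists_norm_one_sub_G_vertical_le
  refine (memLp_weight_abs.const_mul C).mono'
    (measurable_one_sub_G_vertical a).aestronglyMeasurable ?_
  filter_upwards [Measure.ae_ne volume (0 : ℝ)] with t ht
  exact h a t ht

theorem memLp_one_sub_G_imag : MemLp (fun t : ℝ => 1 - G (Complex.I * t)) 2 volume := by
  simpa using memLp_one_sub_G_vertical 0

theorem tendsto_one_sub_G_vertical {t : ℝ} (ht : t ≠ 0) :
    Tendsto (fun a : ℝ => 1 - G ((a : ℂ) + Complex.I * t)) (𝓝[>] 0)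
      (𝓝 (1 - G (Complex.I * t))) := by
  have hs : Complex.I * t ∈ Complex.slitPlane := by
    rw [Complex.mem_slitPlane_iff]; right; simpa using ht
  have hG : ContinuousAt G ((fun a : ℝ => (a : ℂ) + Complex.I * t) 0) := by
    simpa using (differentiableAt_G hs).continuousAt
  have hc : ContinuousAt (fun a : ℝ => (a : ℂ) + Complex.I * t) 0 := by fun_prop
  have hGc := ContinuousAt.comp (f := fun a : ℝ => (a : ℂ) + Complex.I * t) hG hc
  refine Tendsto.mono_left (tendsto_const_nhds.sub ?_) nhdsWithin_le_nhds
  simpa [ContinuousAt, Function.comp_def] using hGc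

theorem tendsto_integral_norm_one_sub_G_sq :
    Tendsto (fun a : ℝ => ∫ t : ℝ, ‖1 - G ((a : ℂ) + Complex.I * t)‖ ^ 2 / (2 * Real.pi))
      (𝓝[>] 0) (𝓝 (∫ t : ℝ, ‖1 - G (Complex.I * t)‖ ^ 2 / (2 * Real.pi))) := by
  obtain ⟨C, h⟩ := exists_norm_one_sub_G_vertical_le
  refine tendsto_integral_filter_of_dominated_convergence
    (fun t => (C * weight |t|) ^ 2 / (2 * Real.pi)) ?_ ?_ ?_ ?_
  · refine .of_forall fun a => ?_
    exact (((measurable_one_sub_G_vertical a).norm.pow_const 2).div_const _).aestronglyMeasurable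
  · refine .of_forall fun a => ?_
    filter_upwards [Measure.ae_ne volume (0 : ℝ)] with t ht
    rw [Real.norm_of_nonneg (by positivity)]
    gcongr
    exact h a t ht
  · exact ((memLp_two_iff_integrable_sq
      (measurable_weight_abs.const_mul C).aestronglyMeasurable).1
        (memLp_weight_abs.const_mul C)).div_const _
  · filter_upwards [Measure.ae_ne volume (0 : ℝ)] with t ht
    exact ((tendsto_one_sub_G_vertical ht).norm.pow 2).div_const _

/-! ### The `L²`-Fourier transform and Plancherel -/

theorem memLp_phiPos : MemLp phiPos 2 (volume : Measure ℝ) := by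
  unfold phiPos
  rw [memLp_indicator_iff_restrict measurableSet_Ici, restrict_Ioi_eq_restrict_Ici.symm]
  exact memLp_phi.ofReal

/-- By Cauchy–Schwarz: on the half-line both the exponential and `φ` are in `L²`. -/
theorem integrable_exp_mul_phiPos {a : ℝ} (ha : 0 < a) :
    Integrable (fun s : ℝ => Complex.exp (-((a : ℂ) * s)) * phiPos s) := by
  have h1 : MemLp (fun s : ℝ => Complex.exp (-((a : ℂ) * s))) 2 (volume.restrict (Ioi 0)) := by
    refine (memLp_two_iff_integrable_sq_norm (Continuous.aestronglyMeasurable (by fun_prop))).2 ?_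
    refine (integrableOn_exp_mul_Ioi (a := -(2 * a)) (by linarith) 0).congr (.of_forall fun s => ?_)
    simp only [Complex.norm_exp, ← Real.exp_nat_mul]
    simp
    ring
  have h2 := h1.integrable_mul memLp_phi.ofReal
  have e : (fun s : ℝ => Complex.exp (-((a : ℂ) * s)) * phiPos s) =
      indicator (Ici 0) fun s : ℝ => Complex.exp (-((a : ℂ) * s)) * (phi s : ℂ) := by
    ext s
    by_cases hs : s ∈ Ici (0 : ℝ) <;> simp [phiPos, hs]
  rw [e, integrable_indicator_iff measurableSet_Ici, IntegrableOn,
    restrict_Ioi_eq_restrict_Ici.symm]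
  exact h2

theorem fourier_exp_mul_phiPos {a : ℝ} (ha : 0 < a) (ξ : ℝ) :
    𝓕 (fun s : ℝ => Complex.exp (-((a : ℂ) * s)) * phiPos s) ξ =
      1 - G ((a : ℂ) + Complex.I * ((2 * Real.pi * ξ : ℝ) : ℂ)) := by
  rw [Real.fourier_real_eq_integral_exp_smul, ← integral_exp_mul_phi (by simpa using ha),
    ← integral_Ici_eq_integral_Ioi, ← integral_indicator measurableSet_Ici]
  congr with s
  by_cases hs : s ∈ Ici (0 : ℝ)
  · simp only [phiPos, hs, indicator_of_mem, smul_eq_mul, ← mul_assoc, ← Complex.exp_add]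
    push_cast
    ring_nf
  · simp [phiPos, hs]

/-- Damping by `e^{-as}` makes the integral form of the transform available, and the transform moves
across the pairing. Both sides then converge as `a → 0+` by dominated convergence. -/
theorem integral_fourier_mul_phiPos (g : SchwartzMap ℝ ℂ) :
    ∫ s : ℝ, 𝓕 g s * phiPos s =
      ∫ ξ : ℝ, g ξ * (1 - G (Complex.I * ((2 * Real.pi * ξ : ℝ) : ℂ))) := by
  have hpi := Real.pi_pos
  have hswap (a : ℝ) (ha : 0 < a) :
      ∫ s : ℝ, 𝓕 g s * (Complex.exp (-((a : ℂ) * s)) * phiPos s) =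
        ∫ ξ : ℝ, g ξ * (1 - G ((a : ℂ) + Complex.I * ((2 * Real.pi * ξ : ℝ) : ℂ))) := by
    have := VectorFourier.integral_fourierIntegral_smul_eq_flip (L := innerₗ ℝ)
      Real.continuous_fourierChar continuous_inner (g.integrable (μ := volume))
      (integrable_exp_mul_phiPos ha)
    simp only [flip_innerₗ] at this
    simp only [← fourier_exp_mul_phiPos ha]
    exact this
  have hlim1 : Tendsto (fun a : ℝ => ∫ s : ℝ, 𝓕 g s * (Complex.exp (-((a : ℂ) * s)) * phiPos s))
      (𝓝[>] 0) (𝓝 (∫ s : ℝ, 𝓕 g s * phiPos s)) := by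
    refine tendsto_integral_filter_of_dominated_convergence
      (fun s => ‖𝓕 g s * phiPos s‖) ?_ ?_ ?_ ?_
    · refine .of_forall fun a => ?_
      exact (𝓕 g).continuous.aestronglyMeasurable.mul
        ((Continuous.aestronglyMeasurable (by fun_prop)).mul memLp_phiPos.1)
    · filter_upwards [self_mem_nhdsWithin] with a ha
      refine .of_forall fun s => ?_
      by_cases hs : s ∈ Ici (0 : ℝ)
      · rw [norm_mul, norm_mul, norm_mul]
        gcongr
        refine mul_le_of_le_one_left (norm_nonneg _) ?_
        rw [Complex.norm_exp, Real.exp_le_one_iff]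
        simpa using mul_nonneg (le_of_lt ha) hs
      · simp [phiPos, hs]
    · exact (((𝓕 g).memLp 2).integrable_mul memLp_phiPos).norm
    · refine .of_forall fun s => Tendsto.mono_left ?_ nhdsWithin_le_nhds
      have : Continuous fun a : ℝ => 𝓕 g s * (Complex.exp (-((a : ℂ) * s)) * phiPos s) := by
        fun_prop
      simpa using this.tendsto 0
  have hlim2 : Tendsto (fun a : ℝ => ∫ ξ : ℝ, g ξ *
      (1 - G ((a : ℂ) + Complex.I * ((2 * Real.pi * ξ : ℝ) : ℂ))))
      (𝓝[>] 0) (𝓝 (∫ ξ : ℝ, g ξ * (1 - G (Complex.I * ((2 * Real.pi * ξ : ℝ) : ℂ))))) := by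
    obtain ⟨C, h⟩ := exists_norm_one_sub_G_vertical_le
    have hne : ∀ᵐ ξ : ℝ, 2 * Real.pi * ξ ≠ 0 := by
      filter_upwards [Measure.ae_ne volume (0 : ℝ)] with ξ hξ
      positivity
    refine tendsto_integral_filter_of_dominated_convergence
      (fun ξ => ‖g ξ‖ * (C * weight |2 * Real.pi * ξ|)) ?_ ?_ ?_ ?_
    · refine .of_forall fun a => g.continuous.aestronglyMeasurable.mul ?_
      exact ((measurable_one_sub_G_vertical a).comp
        (measurable_const_mul (2 * Real.pi))).aestronglyMeasurable
    · refine .of_forall fun a => ?_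
      filter_upwards [hne] with ξ hξ
      rw [norm_mul]
      gcongr
      exact h a _ hξ
    · have hw : MemLp (fun ξ : ℝ => C * weight |2 * Real.pi * ξ|) 2 volume := by
        refine (memLp_two_iff_integrable_sq ?_).2 ?_
        · exact ((measurable_weight_abs.comp
            (measurable_const_mul (2 * Real.pi))).const_mul C).aestronglyMeasurable
        · exact ((memLp_two_iff_integrable_sq
            (measurable_weight_abs.const_mul C).aestronglyMeasurable).1
              (memLp_weight_abs.const_mul C)).comp_mul_left' (by positivity)
      exact (g.memLp 2).norm.integrable_mul hw
    · filter_upwards [hne] with ξ hξ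
      exact (tendsto_one_sub_G_vertical hξ).const_mul _
  refine tendsto_nhds_unique hlim1 (hlim2.congr' ?_)
  filter_upwards [self_mem_nhdsWithin] with a ha
  exact (hswap a ha).symm

theorem memLp_one_sub_G_two_pi :
    MemLp (fun ξ : ℝ => 1 - G (Complex.I * ((2 * Real.pi * ξ : ℝ) : ℂ))) 2 volume := by
  have hm : Measurable fun t : ℝ => 1 - G (Complex.I * t) := by
    have := measurable_G
    fun_prop
  refine (memLp_two_iff_integrable_sq_norm
    (hm.comp (measurable_const_mul (2 * Real.pi))).aestronglyMeasurable).2 ?_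
  exact ((memLp_two_iff_integrable_sq_norm hm.aestronglyMeasurable).1
    memLp_one_sub_G_imag).comp_mul_left' (by positivity [Real.pi_pos])

/-- The embedding of `L²` into tempered distributions is injective and commutes with `𝓕`, so
equality may be tested on Schwartz functions. -/
theorem fourier_phiPos :
    𝓕 (memLp_phiPos.toLp phiPos) = memLp_one_sub_G_two_pi.toLp _ := by
  have hinj := LinearMap.ker_eq_bot.1
    (Lp.ker_toTemperedDistributionCLM_eq_bot (E := ℝ) (F := ℂ) (μ := volume) (p := 2))
  apply hinj
  change Lp.toTemperedDistribution _ = Lp.toTemperedDistribution _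
  rw [← Lp.fourier_toTemperedDistribution_eq]
  ext g
  rw [TemperedDistribution.fourier_apply, Lp.toTemperedDistribution_apply,
    Lp.toTemperedDistribution_apply]
  calc _ = ∫ s : ℝ, 𝓕 g s * phiPos s := by
        refine integral_congr_ae ?_
        filter_upwards [memLp_phiPos.coeFn_toLp] with s hs
        rw [hs, smul_eq_mul]
    _ = _ := integral_fourier_mul_phiPos g
    _ = _ := by
        refine integral_congr_ae ?_
        filter_upwards [memLp_one_sub_G_two_pi.coeFn_toLp] with s hs
        rw [hs, smul_eq_mul]

theorem norm_toLp_two_sq {f : ℝ → ℂ} (hf : MemLp f 2 volume) :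
    ‖hf.toLp f‖ ^ 2 = ∫ x, ‖f x‖ ^ 2 := by
  rw [Lp.norm_toLp, hf.eLpNorm_eq_integral_rpow_norm (by norm_num) (by norm_num),
    ENNReal.toReal_ofReal (by positivity), ← Real.rpow_natCast, ← Real.rpow_mul
      (integral_nonneg fun x => by positivity)]
  norm_num

theorem integral_norm_one_sub_G_sq_eq :
    (∫ t : ℝ, ‖1 - G (Complex.I * t)‖ ^ 2 / (2 * Real.pi)) = ∫ s in Ioi (0 : ℝ), phi s ^ 2 := by
  have hpi := Real.pi_pos
  have h1 := Lp.norm_fourier_eq (memLp_phiPos.toLp phiPos)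
  rw [fourier_phiPos] at h1
  have h2 : (∫ ξ : ℝ, ‖1 - G (Complex.I * ((2 * Real.pi * ξ : ℝ) : ℂ))‖ ^ 2) =
      ∫ s : ℝ, ‖phiPos s‖ ^ 2 := by
    rw [← norm_toLp_two_sq memLp_one_sub_G_two_pi, ← norm_toLp_two_sq memLp_phiPos, h1]
  have h3 := Measure.integral_comp_mul_left
    (fun t : ℝ => ‖1 - G (Complex.I * t)‖ ^ 2) (2 * Real.pi)
  have h4 : (∫ s : ℝ, ‖phiPos s‖ ^ 2) = ∫ s in Ioi (0 : ℝ), phi s ^ 2 := by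
    rw [← integral_Ici_eq_integral_Ioi, ← integral_indicator measurableSet_Ici]
    congr with s
    by_cases hs : s ∈ Ici (0 : ℝ) <;> simp [phiPos, hs]
  rw [← h4, ← h2, h3, integral_div, abs_of_pos (by positivity), smul_eq_mul]
  ring

theorem fourierL2_phiPos :
    fourierL2 (memLp_phiPos.toLp phiPos) =ᵐ[volume] fun t : ℝ => 1 - G (Complex.I * t) := by
  have hpi := Real.pi_pos
  -- Scaling preserves null sets, so the almost everywhere identity in `ξ` transfers to `t = 2πξ`.
  have hq : Measure.QuasiMeasurePreserving (fun t : ℝ => t / (2 * Real.pi)) volume volume := by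
    refine ⟨measurable_id.div_const _, ?_⟩
    have := Real.map_volume_mul_right (a := (2 * Real.pi)⁻¹) (by positivity)
    simp only [div_eq_mul_inv]
    rw [this]
    exact Measure.smul_absolutelyContinuous
  have h := hq.ae memLp_one_sub_G_two_pi.coeFn_toLp
  filter_upwards [h] with t ht
  rw [fourierL2, fourier_phiPos, ht]
  congr 3
  push_cast
  field_simp

end CutPlane

theorem mainTheorem4 :
    -- `φ` is square integrable on `[0, ∞)`
    MemLp CutPlane.phi 2 (volume.restrict (Ici (0 : ℝ))) ∧
    -- `1 - G` is square integrable on every vertical line `Re z = a`, `a ≥ 0`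
    (∀ a : ℝ, 0 ≤ a →
      MemLp (fun t : ℝ => 1 - CutPlane.G ((a : ℂ) + Complex.I * (t : ℂ))) 2 volume) ∧
    -- the limit of the integrals as `a → 0+`
    Tendsto
      (fun a : ℝ =>
        ∫ t : ℝ, ‖1 - CutPlane.G ((a : ℂ) + Complex.I * (t : ℂ))‖ ^ 2 / (2 * Real.pi))
      (𝓝[>] (0 : ℝ))
      (𝓝 (∫ t : ℝ, ‖1 - CutPlane.G (Complex.I * (t : ℂ))‖ ^ 2 / (2 * Real.pi))) ∧
    -- Plancherel's identity on the imaginary axis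
    (∫ t : ℝ, ‖1 - CutPlane.G (Complex.I * (t : ℂ))‖ ^ 2 / (2 * Real.pi)) =
      ∫ s in Ioi (0 : ℝ), CutPlane.phi s ^ 2 ∧
    -- `1 - G(it)` is the `L²`-Fourier transform of `φ · 1_{[0,∞)}`
    ∃ h : MemLp CutPlane.phiPos 2 (volume : Measure ℝ),
      CutPlane.fourierL2 (h.toLp CutPlane.phiPos) =ᵐ[volume]
        fun t : ℝ => 1 - CutPlane.G (Complex.I * (t : ℂ)) := by
  refine ⟨?_, fun a _ => CutPlane.memLp_one_sub_G_vertical a,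
    CutPlane.tendsto_integral_norm_one_sub_G_sq, CutPlane.integral_norm_one_sub_G_sq_eq,
    CutPlane.memLp_phiPos, CutPlane.fourierL2_phiPos⟩
  rw [← restrict_Ioi_eq_restrict_Ici]
  exact CutPlane.memLp_phi
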